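/- **Theorem 2.1.** Let $\Xi\subseteq\mathbb{R}$ be a closed convex set, let $p\in[1,\infty)$ and $\delta\ge 0$, and let $\mathbb{P}_0$ be a probability measure with $\mathbb{P}_0(\Xi)=1$ and $\mathbb{E}_{\mathbb{P}_0}|X|^p<\infty$. Let $$\mathcal{W}_p(\mathbb{P},\mathbb{Q})=\Big(\inf_{\pi}\int |x-y|^p\,\pi(dx,dy)\Big)^{1/p},$$ the infimum being over all joint distributions $\pi$ with marginals $\mathbb{P}$ and $\mathbb{Q}$, and let $B$ be the set of all probability measures $\mathbb{P}$ with $\mathbb{P}(\Xi)=1$ and $\mathcal{W}_p(\mathbb{P},\mathbb{P}_0)\le\delta$. Consider the newsvendor loss $\ell(\theta,x)=b\theta-s\min(\theta,x)$ with $b\in\mathbb{R}$ and $s\ge 0$ (in particular, prices $0<b<s$), fix an order quantity $\theta\ge 0$, and put $$h(\beta;\theta)=\sup_{\mathbb{P}\in B}\mathbb{E}_{\mathbb{P}}[\ell(\theta,X)-\ell(\beta,X)],\qquad \beta\ge 0 .$$ Then $\ell(\beta,X)$ is integrable under every $\mathbb{P}\in B$ for every $\beta\ge 0$, the function $h(\cdot\,;\theta)$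 is finite on $[0,\infty)$, and it is concave on $[0,\theta]$ and on $[\theta,\infty)$. Consequently the regret $$R(\theta)=\sup_{\mathbb{P}\in B}\Big\{\mathbb{E}_{\mathbb{P}}[\ell(\theta,X)]-\inf_{\beta\ge 0}\mathbb{E}_{\mathbb{P}}[\ell(\beta,X)]\Big\}$$ satisfies, in $[-\infty,\infty]$, $$R(\theta)=\max\Big(\sup_{\beta\in[0,\theta]}h(\beta;\theta),\ \sup_{\beta\in[\theta,\infty)}h(\beta;\theta)\Big),$$ that is, it is the maximum of the optimal values of two one-dimensional concave maximization problems. -/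

import Mathlib

open Set MeasureTheory
open scoped ENNReal

noncomputable section

namespace Newsvendor

/-- The newsvendor loss (negative profit): order `θ` at unit price `b`, sell `min θ x` at unit
price `s`, where `x` is the demand. -/
def loss (b s θ x : ℝ) : ℝ := b * θ - s * min θ x

/-- `π` is a joint distribution with marginals `P` and `Q`. -/
def IsCoupling (P Q : Measure ℝ) (π : Measure (ℝ × ℝ)) : Prop :=
  π.map Prod.fst = P ∧ π.map Prod.snd = Q

/-- The type-`p` Wasserstein distance on the real line, with values in `[0, ∞]`. -/
def wassersteinDist (p : ℝ) (P Q : Measure ℝ) : ℝ≥0∞ :=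
  (⨅ π ∈ {π : Measure (ℝ × ℝ) | IsCoupling P Q π},
    ∫⁻ z, ENNReal.ofReal (|z.1 - z.2| ^ p) ∂π) ^ (1 / p)

/-- The closed type-`p` Wasserstein ball of radius `δ` around `P₀` in the set of probability
distributions supported on `Ξ`. -/
def wassersteinBall (Ξ : Set ℝ) (p δ : ℝ) (P₀ : Measure ℝ) : Set (Measure ℝ) :=
  {P | IsProbabilityMeasure P ∧ P Ξᶜ = 0 ∧ wassersteinDist p P P₀ ≤ ENNReal.ofReal δ}

/-- `h(β; θ) = sup_{P ∈ B} E_P[ℓ(θ, X) - ℓ(β, X)]`, as an extended real number. -/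
def worstCaseGap (ℓ : ℝ → ℝ → ℝ) (B : Set (Measure ℝ)) (β θ : ℝ) : EReal :=
  ⨆ P ∈ B, ((∫ x, (ℓ θ x - ℓ β x) ∂P : ℝ) : EReal)

/-- The (ex-ante) worst-case regret
`R(θ) = sup_{P ∈ B} (E_P[ℓ(θ, X)] - inf_{β ∈ Θ} E_P[ℓ(β, X)])`, as an extended real number. -/
def regret (ℓ : ℝ → ℝ → ℝ) (Θ : Set ℝ) (B : Set (Measure ℝ)) (θ : ℝ) : EReal :=
  ⨆ P ∈ B, (((∫ x, ℓ θ x ∂P : ℝ) : EReal) - ⨅ β ∈ Θ, ((∫ x, ℓ β x ∂P : ℝ) : EReal))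

end Newsvendor

end

/-! For `β ≥ θ` the loss gap is `-b * (β - θ) + s * clip (β - θ) (x - θ)`; for `β ≤ θ` it has the
same shape after the reflection `x ↦ -x`. Everything thus reduces to concavity in `v ≥ 0` of `V(v) =
sup_{P ∈ B} E_P[clip v (X - θ)]`. Each expectation is concave in `v`, but a supremum of concave
functions need not be, so the structure of the ball has to enter.

Fix the mean level `v`. The transport budget is priced by a multiplier `l`, up to an error `ε`
(`exists_multiplier`). For a fixed `l`, the penalized gain `sup_u (clip w u - l * |u - y| ^ p)` may
fail to be concave in `w`: a convex kink appears where staying at `y` and moving up to the level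
tie. The remedy is to let the multiplier vary affinely, as `l + k * (w - v)`, with `k` chosen to
cancel the kink. Then for every `y` the penalized gain lies below a line in `w`, and its value at `w
= v` is attained by a transport map `T` (`exists_certificate`).

Integrating the lines against `P₀` bounds `V(w)` by an affine function of `w`, by weak duality. Its
value at `v` is within `ε` of any upper bound for `V(v)`, because `T` induces an admissible plan.
Averaging over `w = v₁, v₂` gives concavity. The map only moves points upward and never beyond the
saturation point, so convexity keeps it inside `Ξ` if `Ξ` reaches that far; otherwise the levels are
first cut down at `sup Ξ`.

The regret formula is an interchange of two suprema. -/

namespace Newsvendor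

/-! ### The truncated gain -/

/-- The truncated positive part `min w (max u 0)`. -/
noncomputable def clip (w u : ℝ) : ℝ := min w (max u 0)

lemma clip_nonneg {w : ℝ} (hw : 0 ≤ w) (u : ℝ) : 0 ≤ clip w u :=
  le_min hw (le_max_right _ _)

lemma clip_le (w u : ℝ) : clip w u ≤ w := min_le_left _ _

lemma clip_of_nonpos {w u : ℝ} (hw : 0 ≤ w) (hu : u ≤ 0) : clip w u = 0 := by
  simp [clip, max_eq_right hu, hw]

lemma clip_of_nonneg (w : ℝ) {u : ℝ} (hu : 0 ≤ u) : clip w u = min w u := by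
  simp [clip, max_eq_left hu]

lemma clip_mono {w w' u u' : ℝ} (hw : w ≤ w') (hu : u ≤ u') : clip w u ≤ clip w' u' :=
  min_le_min hw (max_le_max hu le_rfl)

lemma abs_clip_le {w : ℝ} (hw : 0 ≤ w) (u : ℝ) : |clip w u| ≤ w := by
  rw [abs_of_nonneg (clip_nonneg hw u)]; exact clip_le w u

lemma clip_sub_le (w u y : ℝ) : clip w u ≤ clip w y + |u - y| := by
  have h1 := le_abs_self (u - y)
  have h2 := abs_nonneg (u - y)
  unfold clip
  rcases le_total w (max y 0) with h | h
  · rw [min_eq_left h]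
    exact (min_le_left _ _).trans (by linarith)
  · rw [min_eq_right h]
    refine (min_le_right _ _).trans (max_le ?_ ?_)
    · linarith [le_max_left y 0]
    · linarith [le_max_right y 0]

lemma continuous_clip (w : ℝ) : Continuous (clip w) := by
  unfold clip; fun_prop

/-! ### Supporting lines for the penalized gain -/

/-- Bernoulli's inequality at `|s| / q - 1`, scaled by `q ^ p`; the tangent slope is nonnegative, so
`|s|` may be replaced by `s` on the left. -/
lemma rpow_tangent_le {p q : ℝ} (hp : 1 ≤ p) (hq : 0 < q) (s : ℝ) :
    q ^ p + p * q ^ (p - 1) * (s - q) ≤ |s| ^ p := by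
  have hs : s ≤ |s| := le_abs_self s
  have hs0 := abs_nonneg s
  have h1 := one_add_mul_self_le_rpow_one_add (s := |s| / q - 1)
    (by have : 0 ≤ |s| / q := by positivity
        linarith) hp
  have h2 : (1 + (|s| / q - 1)) ^ p = |s| ^ p / q ^ p := by
    rw [add_sub_cancel, Real.div_rpow hs0 hq.le]
  rw [h2, le_div_iff₀ (by positivity)] at h1
  have h3 : q ^ p = q ^ (p - 1) * q := by
    rw [← Real.rpow_add_one hq.ne']; congr 1; ring
  have h4 : (1 + p * (|s| / q - 1)) * q ^ p = q ^ p + p * q ^ (p - 1) * (|s| - q) := by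
    rw [h3]; field_simp
  have h5 : 0 ≤ p * q ^ (p - 1) := by positivity
  nlinarith

/-- A supporting line, in the truncation level `w`, of the penalized truncated gain. -/
lemma clip_sub_penalty_le {p l k v y A' : ℝ} (hp : 1 ≤ p) (hk : 0 ≤ k) (hkv : k * v ≤ l)
    (hy : y < v) (hA' : A' = 1 - k * (v - y) ^ p - l * (p * (v - y) ^ (p - 1)))
    (hA'0 : 0 ≤ A') (hA : v * A' ≤ v - l * (v - y) ^ p) {w : ℝ} (hw : 0 ≤ w) (u : ℝ) :
    clip w u - (l + k * (w - v)) * |u - y| ^ p ≤ v - l * (v - y) ^ p + A' * (w - v) := by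
  have hq : 0 < v - y := by linarith
  have hlw : 0 ≤ l + k * (w - v) := by nlinarith
  have hpow : 0 ≤ |u - y| ^ p := by positivity
  -- For `u ≤ 0` there is no gain, and the line is nonnegative: `hA` says so at `w = 0`, and its
  -- slope is `A' ≥ 0`. For `u ≥ 0`, lowering the level to `m = min w u` and using the tangent at `v
  -- - y` leaves the line at `m` minus `k * c * (m - v) ^ 2`.
  rcases le_total u 0 with hu | hu
  · rw [clip_of_nonpos hw hu]
    nlinarith [mul_nonneg hlw hpow, mul_nonneg hA'0 hw]
  · rw [clip_of_nonneg w hu]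
    set m := min w u
    have hm0 : 0 ≤ m := le_min hw hu
    have hmw : m ≤ w := min_le_left _ _
    have hmu : m ≤ u := min_le_right _ _
    have ht := rpow_tangent_le hp hq (u - y)
    have hc : 0 ≤ p * (v - y) ^ (p - 1) := by positivity
    generalize p * (v - y) ^ (p - 1) = c at *
    generalize (v - y) ^ p = r at *
    generalize |u - y| ^ p = R at *
    have hR : r + c * (m - v) ≤ R := by nlinarith
    have hlm : 0 ≤ l + k * (m - v) := by nlinarith
    have h1 : (l + k * (m - v)) * R ≤ (l + k * (w - v)) * R := by gcongr
    have h2 := mul_le_mul_of_nonneg_left hR hlm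
    have h3 : A' * (m - v) ≤ A' * (w - v) := by gcongr
    have h4 : 0 ≤ k * c * (m - v) ^ 2 := by positivity
    subst hA'
    nlinarith

/-- The data of a Lagrangian certificate for the truncated gain at the level `v`, with
multiplier `l`: a transport map `T`, and a supporting line `A + A' * (w - v)` of the penalized gain
as a function of the level `w`, the multiplier at level `w` being `l + k * (w - v)`. -/
structure IsCertificate (p l v k : ℝ) (T A A' : ℝ → ℝ) : Prop where
  k_nonneg : 0 ≤ k
  k_mul_le : k * v ≤ l
  measurable_map : Measurable T
  measurable_value : Measurable A
  measurable_slope : Measurable A'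
  value_mem : ∀ y, A y ∈ Icc 0 v
  slope_mem : ∀ y, A' y ∈ Icc (0 : ℝ) 1
  map_eq_or : ∀ y, T y = y ∨ y ≤ T y ∧ T y ≤ v
  value_le : ∀ y, A y ≤ clip v (T y) - l * |T y - y| ^ p
  le_line : ∀ y w u, 0 ≤ w →
    clip w u - (l + k * (w - v)) * |u - y| ^ p ≤ A y + A' y * (w - v)

/-- With `l * t ^ p = v`, it pays to jump to `v` from every `y` in `(v - t, v)`, with indifference
at `v - t`. Under a fixed multiplier the slope in the level would drop there from `1 - ρ` to `0`;
this is the kink that `k` removes. -/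
lemma exists_certificate_of_le {p l v : ℝ} (hp : 1 ≤ p) (hl : 0 < l) (hv : 0 < v)
    (hlv : l * (p * v) ^ p ≤ v) : ∃ k T A A', IsCertificate p l v k T A A' := by
  have hp0 : 0 < p := by linarith
  obtain ⟨t, ht0, ht, htv⟩ : ∃ t : ℝ, 0 < t ∧ l * t ^ p = v ∧ p * v ≤ t := by
    refine ⟨(v / l) ^ (1 / p), by positivity, ?_, ?_⟩
    · rw [← Real.rpow_mul (by positivity), one_div_mul_cancel hp0.ne', Real.rpow_one]
      field_simp
    · have : (p * v) ^ p ≤ v / l := by rw [le_div_iff₀ hl]; linarith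
      have h2 := Real.rpow_le_rpow (by positivity) this (z := 1 / p) (by positivity)
      rwa [← Real.rpow_mul (by positivity), mul_one_div_cancel hp0.ne', Real.rpow_one] at h2
  have hvt : v ≤ t := le_trans (by nlinarith) htv
  have htp : 0 < t ^ p := by positivity
  have ht1 : t ^ p = t ^ (p - 1) * t := by
    rw [← Real.rpow_add_one ht0.ne']; congr 1; ring
  set ρ := p * v / t with hρ
  have hρ0 : 0 ≤ ρ := by positivity
  have hρ1 : ρ ≤ 1 := by rw [hρ, div_le_one ht0]; exact htv
  have hρt : ρ * t = p * v := by rw [hρ]; field_simp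
  -- Chosen so that `k * t ^ p + l * (p * t ^ (p - 1)) = 1`: at `y = v - t` both value and slope
  -- vanish.
  set k := (1 - ρ) / t ^ p with hkdef
  have hk : 0 ≤ k := div_nonneg (by linarith) htp.le
  have hkt : k * t ^ p = 1 - ρ := by rw [hkdef]; field_simp
  have hkv : k * v = l * (1 - ρ) := by rw [← ht, ← hkt]; ring
  have hkvl : k * v ≤ l := by rw [hkv]; nlinarith
  have hlt : l * (p * t ^ (p - 1)) = ρ := by
    have : l * (p * t ^ (p - 1)) * t = ρ * t := by rw [hρt, ← ht, ht1]; ring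
    exact mul_right_cancel₀ ht0.ne' this
  let s : Set ℝ := Ioo (v - t) v
  have hs : MeasurableSet s := measurableSet_Ioo
  let slope : ℝ → ℝ := fun y => 1 - k * (v - y) ^ p - l * (p * (v - y) ^ (p - 1))
  have slope_nonneg : ∀ y, v - t ≤ y → y < v → 0 ≤ slope y := by
    intro y h1 h2
    have hq : 0 ≤ v - y := by linarith
    have e1 : (v - y) ^ p ≤ t ^ p := Real.rpow_le_rpow hq (by linarith) (by linarith)
    have e2 : (v - y) ^ (p - 1) ≤ t ^ (p - 1) := Real.rpow_le_rpow hq (by linarith) (by linarith)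
    have e3 : k * (v - y) ^ p ≤ k * t ^ p := by gcongr
    have e4 : l * (p * (v - y) ^ (p - 1)) ≤ l * (p * t ^ (p - 1)) := by gcongr
    simp only [slope]; linarith
  have slope_le : ∀ y, y < v → slope y ≤ 1 := by
    intro y h2
    have hq : 0 ≤ v - y := by linarith
    have e1 : 0 ≤ k * (v - y) ^ p := by positivity
    have e2 : 0 ≤ l * (p * (v - y) ^ (p - 1)) := by positivity
    simp only [slope]; linarith
  have value_ge : ∀ y, v - t ≤ y → y < v → v * slope y ≤ v - l * (v - y) ^ p := by
    intro y h1 h2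
    have hq : 0 < v - y := by linarith
    have e : (v - y) ^ p = (v - y) ^ (p - 1) * (v - y) := by
      rw [← Real.rpow_add_one hq.ne']; congr 1; ring
    have e2 : 0 ≤ l * (v - y) ^ (p - 1) * (p * v - ρ * (v - y)) := by
      rw [← hρt]
      have : ρ * (v - y) ≤ ρ * t := by gcongr; linarith
      have : 0 ≤ ρ * t - ρ * (v - y) := by linarith
      positivity
    have e3 : v - l * (v - y) ^ p - v * slope y
        = l * (v - y) ^ (p - 1) * (p * v - ρ * (v - y)) := by
      simp only [slope]
      calc _ = -l * (v - y) ^ p + (k * v) * (v - y) ^ p + v * (l * (p * (v - y) ^ (p - 1))) := by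
            ring
        _ = _ := by rw [hkv, e]; ring
    linarith
  classical
  refine ⟨k, fun y => if y ∈ s then v else y,
    fun y => if y ∈ s then v - l * (v - y) ^ p else if v ≤ y then v else 0,
    fun y => if y ∈ s then slope y else if v ≤ y then 1 else 0, hk, hkvl, ?_, ?_, ?_, ?_, ?_, ?_,
    ?_, ?_⟩
  · exact Measurable.ite hs measurable_const measurable_id
  · exact Measurable.ite hs (by fun_prop)
      (Measurable.ite measurableSet_Ici measurable_const measurable_const)
  · exact Measurable.ite hs (by fun_prop)
      (Measurable.ite measurableSet_Ici measurable_const measurable_const)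
  · intro y
    split_ifs with h1 h2
    · have := value_ge y h1.1.le h1.2
      have h3 := slope_nonneg y h1.1.le h1.2
      have hq : 0 ≤ v - y := by linarith [h1.2]
      have h4 : 0 ≤ l * (v - y) ^ p := by positivity
      exact ⟨le_trans (by positivity) this, by linarith⟩
    · exact ⟨hv.le, le_rfl⟩
    · exact ⟨le_rfl, hv.le⟩
  · intro y
    split_ifs with h1 h2
    · exact ⟨slope_nonneg y h1.1.le h1.2, slope_le y h1.2⟩
    · simp
    · simp
  · intro y
    split_ifs with h1
    · exact Or.inr ⟨h1.2.le, le_rfl⟩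
    · exact Or.inl rfl
  · intro y
    split_ifs with h1 h2
    · rw [clip_of_nonneg _ hv.le, min_self, abs_of_pos (by linarith [h1.2])]
    · rw [clip_of_nonneg _ (hv.le.trans h2), min_eq_left h2, sub_self, abs_zero,
        Real.zero_rpow hp0.ne']
      simp
    · rw [sub_self, abs_zero, Real.zero_rpow hp0.ne']
      simpa using clip_nonneg hv.le y
  · intro y w u hw
    have hlw : 0 ≤ l + k * (w - v) := by nlinarith
    have hpow : 0 ≤ |u - y| ^ p := by positivity
    split_ifs with h1 h2
    · exact clip_sub_penalty_le hp hk hkvl h1.2 rfl (slope_nonneg y h1.1.le h1.2)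
        (value_ge y h1.1.le h1.2) hw u
    · linarith [clip_le w u, mul_nonneg hlw hpow]
    · have hyt : y ≤ v - t := by
        by_contra h
        exact h1 ⟨not_le.1 h, not_le.1 h2⟩
      rcases le_total u 0 with hu | hu
      · rw [clip_of_nonpos hw hu]
        linarith [mul_nonneg hlw hpow]
      -- Starting further left only costs more, and the line for the base point `v - t` is
      -- identically zero.
      · have h3 := clip_sub_penalty_le hp hk hkvl (y := v - t) (by linarith) rfl
          (slope_nonneg _ le_rfl (by linarith)) (value_ge _ le_rfl (by linarith)) hw u
        have h4 : |u - (v - t)| ^ p ≤ |u - y| ^ p := by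
          apply Real.rpow_le_rpow (abs_nonneg _) _ hp0.le
          rw [abs_of_nonneg (by linarith), abs_of_nonneg (by linarith)]
          linarith
        have h5 := mul_le_mul_of_nonneg_left h4 hlw
        rw [sub_sub_cancel, hkt, hlt, ht] at h3
        linarith

/-- For `p > 1`, `τ` solves the first-order condition `l * p * τ ^ (p - 1) = 1`. For `p = 1`, `l ≥
1` makes every move unprofitable, so `τ = 0` and the last clause is vacuous. -/
lemma exists_penalty_maximizer {p l : ℝ} (hp : 1 ≤ p) (hl : 0 < l) (h : p = 1 → 1 ≤ l) :
    ∃ τ : ℝ, 0 ≤ τ ∧ (∀ s, s - l * |s| ^ p ≤ τ - l * τ ^ p) ∧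
      ∀ q, 0 < q → q ≤ τ → l * (p * q ^ (p - 1)) ≤ 1 := by
  rcases hp.eq_or_lt with rfl | hp1
  · refine ⟨0, le_rfl, fun s => ?_, fun q h1 h2 => absurd h1 (not_lt.2 h2)⟩
    have := h rfl
    simp only [Real.rpow_one]
    nlinarith [le_abs_self s, abs_nonneg s]
  · have hp0 : 0 < p - 1 := by linarith
    have hlp : 0 < l * p := by positivity
    have hτ : ((l * p)⁻¹ ^ (1 / (p - 1))) ^ (p - 1) = (l * p)⁻¹ := by
      rw [← Real.rpow_mul (by positivity), one_div_mul_cancel hp0.ne', Real.rpow_one]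
    have hτ0 : 0 < (l * p)⁻¹ ^ (1 / (p - 1)) := by positivity
    generalize (l * p)⁻¹ ^ (1 / (p - 1)) = τ at *
    have hτ1 : l * (p * τ ^ (p - 1)) = 1 := by rw [hτ]; field_simp
    refine ⟨τ, hτ0.le, fun s => ?_, fun q h1 h2 => ?_⟩
    · have := mul_le_mul_of_nonneg_left (rpow_tangent_le hp hτ0 s) hl.le
      have e : l * (τ ^ p + p * τ ^ (p - 1) * (s - τ))
        = l * τ ^ p + l * (p * τ ^ (p - 1)) * (s - τ) := by ring
      rw [e, hτ1] at this
      linarith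
    · have h3 : q ^ (p - 1) ≤ τ ^ (p - 1) := Real.rpow_le_rpow h1.le h2 hp0.le
      calc l * (p * q ^ (p - 1)) ≤ l * (p * τ ^ (p - 1)) := by gcongr
        _ = 1 := hτ1

/-- Here a constant multiplier suffices. Points within the optimal step `τ` of `v` jump to `v`;
points further away move by `τ` if that is profitable, with a value independent of the level; the
others stay. The cutoff `v - y < p * v` keeps the line nonnegative at level `0`. -/
lemma exists_certificate_of_ge {p l v : ℝ} (hp : 1 ≤ p) (hl : 0 < l) (hv : 0 < v)
    (hlv : v ≤ l * (p * v) ^ p) : ∃ k T A A', IsCertificate p l v k T A A' := by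
  have hp0 : 0 < p := by linarith
  obtain ⟨τ, hτ0, hτ, hτ'⟩ := exists_penalty_maximizer hp hl (by
    rintro rfl
    rw [one_mul, Real.rpow_one] at hlv
    exact (le_mul_iff_one_le_left hv).1 hlv)
  have hτp : 0 ≤ l * τ ^ p := by positivity
  let s : Set ℝ := {y | v - p * v < y ∧ y < v ∧ v - y ≤ τ}
  let r : Set ℝ := {y | v - p * v < y ∧ y < v ∧ τ < v - y ∧ 0 < y + τ - l * τ ^ p}
  have hs : MeasurableSet s := by measurability
  have hr : MeasurableSet r := by
    have h1 : MeasurableSet {y : ℝ | τ < v - y} := measurableSet_lt (by fun_prop) (by fun_prop)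
    have h2 : MeasurableSet {y : ℝ | 0 < y + τ - l * τ ^ p} :=
      measurableSet_lt (by fun_prop) (by fun_prop)
    exact measurableSet_Ioi.inter (measurableSet_Iio.inter (h1.inter h2))
  let slope : ℝ → ℝ := fun y => 1 - 0 * (v - y) ^ p - l * (p * (v - y) ^ (p - 1))
  have slope_nonneg : ∀ y ∈ s, 0 ≤ slope y := by
    intro y h
    have := hτ' (v - y) (by linarith [h.2.1]) h.2.2
    simp only [slope]; linarith
  have slope_le : ∀ y ∈ s, slope y ≤ 1 := by
    intro y h
    have hq : 0 ≤ v - y := by linarith [h.2.1]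
    have e2 : 0 ≤ l * (p * (v - y) ^ (p - 1)) := by positivity
    simp only [slope]; linarith
  have value_ge : ∀ y ∈ s, v * slope y ≤ v - l * (v - y) ^ p := by
    intro y h
    have hq : 0 < v - y := by linarith [h.2.1]
    have e : (v - y) ^ p = (v - y) ^ (p - 1) * (v - y) := by
      rw [← Real.rpow_add_one hq.ne']; congr 1; ring
    have e2 : 0 ≤ l * (v - y) ^ (p - 1) * (p * v - (v - y)) := by
      have : 0 ≤ p * v - (v - y) := by linarith [h.1]
      positivity
    simp only [slope]
    rw [e]
    nlinarith
  classical
  refine ⟨0, fun y => if y ∈ s then v else if y ∈ r then y + τ else y,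
    fun y => if y ∈ s then v - l * (v - y) ^ p else if y ∈ r then y + τ - l * τ ^ p else
      if v ≤ y then v else 0,
    fun y => if y ∈ s then slope y else if y ∈ r then 0 else if v ≤ y then 1 else 0,
    le_rfl, by simpa using hl.le, ?_, ?_, ?_, ?_, ?_, ?_, ?_, ?_⟩
  · exact Measurable.ite hs measurable_const (Measurable.ite hr (by fun_prop) measurable_id)
  · exact Measurable.ite hs (by fun_prop) (Measurable.ite hr (by fun_prop)
      (Measurable.ite measurableSet_Ici measurable_const measurable_const))
  · exact Measurable.ite hs (by fun_prop) (Measurable.ite hr (by fun_prop)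
      (Measurable.ite measurableSet_Ici measurable_const measurable_const))
  · intro y
    split_ifs with h1 h2 h3
    · have := value_ge y h1
      have h3 := slope_nonneg y h1
      have hq : 0 ≤ v - y := by linarith [h1.2.1]
      have h4 : 0 ≤ l * (v - y) ^ p := by positivity
      exact ⟨le_trans (by positivity) this, by linarith⟩
    · exact ⟨h2.2.2.2.le, by linarith [h2.2.2.1]⟩
    · exact ⟨hv.le, le_rfl⟩
    · exact ⟨le_rfl, hv.le⟩
  · intro y
    split_ifs with h1 h2 h3
    · exact ⟨slope_nonneg y h1, slope_le y h1⟩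
    all_goals simp
  · intro y
    split_ifs with h1 h2
    · exact Or.inr ⟨h1.2.1.le, le_rfl⟩
    · exact Or.inr ⟨by linarith, by linarith [h2.2.2.1]⟩
    · exact Or.inl rfl
  · intro y
    split_ifs with h1 h2 h3
    · rw [clip_of_nonneg _ hv.le, min_self, abs_of_pos (by linarith [h1.2.1])]
    · rw [clip_of_nonneg _ (by linarith [h2.2.2.2]), min_eq_right (by linarith [h2.2.2.1]),
        add_sub_cancel_left, abs_of_nonneg hτ0]
    · rw [clip_of_nonneg _ (hv.le.trans h3), min_eq_left h3, sub_self, abs_zero,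
        Real.zero_rpow hp0.ne']
      simp
    · rw [sub_self, abs_zero, Real.zero_rpow hp0.ne']
      simpa using clip_nonneg hv.le y
  · intro y w u hw
    have hpow : 0 ≤ l * |u - y| ^ p := by positivity
    have key : ∀ z, 0 ≤ z → u - l * |u - y| ^ p ≤ z →
        clip w u - (l + 0 * (w - v)) * |u - y| ^ p ≤ z + 0 * (w - v) := by
      intro z hz h
      rcases le_total u 0 with hu | hu
      · rw [clip_of_nonpos hw hu]
        linarith
      · rw [clip_of_nonneg w hu]
        linarith [min_le_right w u]
    have hmax : u - l * |u - y| ^ p ≤ y + τ - l * τ ^ p := by linarith [hτ (u - y)]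
    split_ifs with h1 h2 h3
    · exact clip_sub_penalty_le hp le_rfl (by simpa using hl.le) h1.2.1 rfl (slope_nonneg y h1)
        (value_ge y h1) hw u
    · exact key _ h2.2.2.2.le hmax
    · linarith [clip_le w u]
    · refine key 0 le_rfl ?_
      rcases lt_or_ge (v - p * v) y with h4 | h4
      · have h5 : τ < v - y := by
          by_contra h
          exact h1 ⟨h4, not_le.1 h3, not_lt.1 h⟩
        have h6 : y + τ - l * τ ^ p ≤ 0 := by
          by_contra h
          exact h2 ⟨h4, not_le.1 h3, h5, not_le.1 h⟩
        linarith
      -- For `y ≤ v - p * v` no move pays: the tangent to the cost at distance `p * v` from `v - p *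
      -- v` vanishes at `u = 0` and equals `(p * v) ^ p * u / v`, which is at least `u / l` for `u ≥
      -- 0`.
      · rcases le_total u 0 with hu | hu
        · linarith
        · have hpv : 0 < p * v := by positivity
          have e : (p * v) ^ p = (p * v) ^ (p - 1) * (p * v) := by
            rw [← Real.rpow_add_one hpv.ne']; congr 1; ring
          have hvp : v ≤ p * v := by nlinarith
          have h5 := rpow_tangent_le hp hpv (u - (v - p * v))
          have h6 : |u - (v - p * v)| ^ p ≤ |u - y| ^ p := by
            apply Real.rpow_le_rpow (abs_nonneg _) _ hp0.le
            rw [abs_of_nonneg (by linarith), abs_of_nonneg (by linarith)]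
            linarith
          have h7 : ((p * v) ^ p + p * (p * v) ^ (p - 1) * (u - (v - p * v) - p * v)) * v
              = (p * v) ^ p * u := by rw [e]; ring
          have h8 : (p * v) ^ p * u ≤ |u - y| ^ p * v := by
            rw [← h7]; gcongr; exact h5.trans h6
          have h9 : v * u ≤ v * (l * |u - y| ^ p) := by
            calc v * u ≤ l * (p * v) ^ p * u := by gcongr
              _ = l * ((p * v) ^ p * u) := by ring
              _ ≤ l * (|u - y| ^ p * v) := by gcongr
              _ = _ := by ring
          linarith [le_of_mul_le_mul_left h9 hv]

theorem exists_certificate {p l v : ℝ} (hp : 1 ≤ p) (hl : 0 < l) (hv : 0 < v) :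
    ∃ k T A A', IsCertificate p l v k T A A' := by
  rcases le_total (l * (p * v) ^ p) v with h | h
  · exact exists_certificate_of_le hp hl hv h
  · exact exists_certificate_of_ge hp hl hv h

/-! ### Transport plans and the Lagrange multiplier -/

/-- A supergradient, at the abscissa `c`, of the upper boundary of a convex planar set. -/
lemma exists_supergradient {S : Set (ℝ × ℝ)} (hS : Convex ℝ S) {c H : ℝ} (hc : 0 < c) {f₀ : ℝ}
    (h₀ : ((0 : ℝ), f₀) ∈ S) (hH : ∀ z ∈ S, z.1 ≤ c → z.2 ≤ H) :
    ∃ l, 0 ≤ l ∧ ∀ z ∈ S, z.2 ≤ H + l * (z.1 - c) := by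
  have hf₀ : f₀ ≤ H := hH _ h₀ hc.le
  -- A chord across the abscissa `c` passes it at height at most `H`, so slopes to the right of `(c,
  -- H)` are at most slopes to the left.
  have cross : ∀ z ∈ S, ∀ z' ∈ S, c < z.1 → z'.1 < c →
      (z.2 - H) / (z.1 - c) ≤ (H - z'.2) / (c - z'.1) := by
    intro z hz z' hz' h h'
    have h1 : 0 < z.1 - c := by linarith
    have h2 : 0 < c - z'.1 := by linarith
    have h3 : 0 < z.1 - z'.1 := by linarith
    have hmem := hS hz hz' (a := (c - z'.1) / (z.1 - z'.1)) (b := (z.1 - c) / (z.1 - z'.1))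
      (by positivity) (by positivity) (by field_simp; ring)
    have := hH _ hmem (by
      simp only [Prod.fst_add, Prod.smul_fst, smul_eq_mul]
      apply le_of_eq
      field_simp
      ring)
    simp only [Prod.snd_add, Prod.smul_snd, smul_eq_mul] at this
    rw [div_mul_eq_mul_div, div_mul_eq_mul_div, ← add_div, div_le_iff₀ h3] at this
    rw [div_le_div_iff₀ h1 h2]
    nlinarith
  -- Adjoining `0` makes the supremum of the right slopes a nonnegative multiplier.
  let U : Set ℝ := {r | r = 0 ∨ ∃ z ∈ S, c < z.1 ∧ r = (z.2 - H) / (z.1 - c)}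
  have hU : ∀ z' ∈ S, z'.1 < c → (H - z'.2) / (c - z'.1) ∈ upperBounds U := by
    rintro z' hz' h' r (rfl | ⟨z, hz, h, rfl⟩)
    · have := hH _ hz' h'.le
      exact div_nonneg (by linarith) (by linarith)
    · exact cross z hz z' hz' h h'
  have hbdd : BddAbove U := ⟨_, hU _ h₀ hc⟩
  refine ⟨sSup U, le_csSup hbdd (Or.inl rfl), fun z hz => ?_⟩
  rcases lt_trichotomy z.1 c with h | h | h
  · have := csSup_le (s := U) ⟨0, Or.inl rfl⟩ (hU z hz h)
    rw [le_div_iff₀ (by linarith)] at this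
    linarith
  · have := hH z hz h.le
    rw [h]; simpa using this
  · have := le_csSup hbdd (show (z.2 - H) / (z.1 - c) ∈ U from Or.inr ⟨z, hz, h, rfl⟩)
    rw [div_le_iff₀ (by linarith)] at this
    linarith

/-- Only `s > ε` matters, where `ε ^ (p - 1) ≤ s ^ (p - 1)`. This supplies an explicit multiplier
when the radius is zero. -/
lemma le_add_mul_rpow {p ε s : ℝ} (hp : 1 ≤ p) (hε : 0 < ε) (hs : 0 ≤ s) :
    s ≤ ε + ε ^ (1 - p) * s ^ p := by
  rcases le_total s ε with h | h
  · have : 0 ≤ ε ^ (1 - p) * s ^ p := by positivity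
    linarith
  · have hs0 : 0 < s := hε.trans_le h
    have h1 : ε ^ (p - 1) ≤ s ^ (p - 1) := Real.rpow_le_rpow hε.le h (by linarith)
    have h2 : s ^ p = s ^ (p - 1) * s := by
      rw [← Real.rpow_add_one hs0.ne']; congr 1; ring
    have h3 : ε ^ (1 - p) * ε ^ (p - 1) = 1 := by
      rw [← Real.rpow_add hε]; simp
    have h4 : 0 < ε ^ (1 - p) := by positivity
    calc s = (ε ^ (1 - p) * ε ^ (p - 1)) * s := by rw [h3, one_mul]
      _ ≤ (ε ^ (1 - p) * s ^ (p - 1)) * s := by gcongr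
      _ = ε ^ (1 - p) * s ^ p := by rw [h2]; ring
      _ ≤ _ := by linarith

lemma le_one_add_rpow {p s : ℝ} (hp : 1 ≤ p) (hs : 0 ≤ s) : s ≤ 1 + s ^ p := by
  simpa using le_add_mul_rpow hp one_pos hs

/-- A transport plan of finite cost to `P₀` from some probability measure supported on `Ξ`. -/
structure IsPlan (Ξ : Set ℝ) (p : ℝ) (P₀ : Measure ℝ) (π : Measure (ℝ × ℝ)) : Prop where
  prob : IsProbabilityMeasure π
  map_snd : π.map Prod.snd = P₀
  fst_compl : π.map Prod.fst Ξᶜ = 0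
  integrable_cost : Integrable (fun z : ℝ × ℝ => |z.1 - z.2| ^ p) π

/-- The transport cost of a plan. -/
noncomputable def cost (p : ℝ) (π : Measure (ℝ × ℝ)) : ℝ := ∫ z, |z.1 - z.2| ^ p ∂π

variable {Ξ : Set ℝ} {p δ : ℝ} {P₀ : Measure ℝ}

lemma cost_nonneg (p : ℝ) (π : Measure (ℝ × ℝ)) : 0 ≤ cost p π :=
  integral_nonneg fun _ => by positivity

lemma measurable_cost (p : ℝ) : Measurable fun z : ℝ × ℝ => |z.1 - z.2| ^ p := by
  have : Measurable fun z : ℝ × ℝ => |z.1 - z.2| :=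
    (continuous_abs.comp (continuous_fst.sub continuous_snd)).measurable
  exact this.pow_const p

lemma exists_plan {P : Measure ℝ} (hp : 1 ≤ p) (hδ : 0 ≤ δ)
    (hP : P ∈ wassersteinBall Ξ p δ P₀) {η : ℝ} (hη : 0 < η) :
    ∃ π, IsPlan Ξ p P₀ π ∧ π.map Prod.fst = P ∧ cost p π ≤ δ ^ p + η := by
  obtain ⟨hprob, hΞ, hW⟩ := hP
  have hp0 : 0 < p := by linarith
  have hδp : 0 ≤ δ ^ p := by positivity
  unfold wassersteinDist at hW
  rw [one_div, ENNReal.rpow_inv_le_iff hp0, ENNReal.ofReal_rpow_of_nonneg hδ hp0.le] at hW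
  have hlt := hW.trans_lt ((ENNReal.ofReal_lt_ofReal_iff (q := δ ^ p + η) (by linarith)).2
    (by linarith))
  simp only [iInf_lt_iff, mem_ofPred_eq] at hlt
  obtain ⟨π, ⟨h1, h2⟩, hπ⟩ := hlt
  have hπprob : IsProbabilityMeasure π := by
    constructor
    have := hprob.measure_univ
    rwa [← h1, Measure.map_apply measurable_fst MeasurableSet.univ, preimage_univ] at this
  have hint : Integrable (fun z : ℝ × ℝ => |z.1 - z.2| ^ p) π := by
    refine ⟨(measurable_cost p).aestronglyMeasurable, ?_⟩
    rw [hasFiniteIntegral_iff_ofReal (ae_of_all _ fun _ => by positivity)]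
    exact hπ.trans ENNReal.ofReal_lt_top
  refine ⟨π, ⟨hπprob, h2, by rw [h1]; exact hΞ, hint⟩, h1, ?_⟩
  rw [← ofReal_integral_eq_lintegral_ofReal hint (ae_of_all _ fun _ => by positivity)] at hπ
  exact ((ENNReal.ofReal_lt_ofReal_iff (by linarith)).1 hπ).le

lemma IsPlan.map_fst_mem {π : Measure (ℝ × ℝ)} (hπ : IsPlan Ξ p P₀ π) (hp : 1 ≤ p) (hδ : 0 ≤ δ)
    (h : cost p π ≤ δ ^ p) : π.map Prod.fst ∈ wassersteinBall Ξ p δ P₀ := by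
  have := hπ.prob
  have hp0 : 0 < p := by linarith
  refine ⟨Measure.isProbabilityMeasure_map measurable_fst.aemeasurable, hπ.fst_compl, ?_⟩
  unfold wassersteinDist
  rw [one_div, ENNReal.rpow_inv_le_iff hp0, ENNReal.ofReal_rpow_of_nonneg hδ hp0.le]
  refine (iInf₂_le π ⟨rfl, hπ.map_snd⟩).trans ?_
  rw [← ofReal_integral_eq_lintegral_ofReal hπ.integrable_cost (ae_of_all _ fun _ => by positivity)]
  exact ENNReal.ofReal_le_ofReal h

lemma IsPlan.convexComb {π π' : Measure (ℝ × ℝ)} (hπ : IsPlan Ξ p P₀ π) (hπ' : IsPlan Ξ p P₀ π')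
    {a a' : ℝ} (ha : 0 ≤ a) (ha' : 0 ≤ a') (haa : a + a' = 1) :
    IsPlan Ξ p P₀ (ENNReal.ofReal a • π + ENNReal.ofReal a' • π') := by
  have := hπ.prob
  have := hπ'.prob
  have h1 : ENNReal.ofReal a + ENNReal.ofReal a' = 1 := by
    rw [← ENNReal.ofReal_add ha ha', haa, ENNReal.ofReal_one]
  refine ⟨⟨by simp [h1]⟩, ?_, ?_, ?_⟩
  · rw [Measure.map_add _ _ measurable_snd, Measure.map_smul, Measure.map_smul, hπ.map_snd,
      hπ'.map_snd, ← add_smul, h1, one_smul]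
  · rw [Measure.map_add _ _ measurable_fst, Measure.map_smul, Measure.map_smul]
    simp [hπ.fst_compl, hπ'.fst_compl]
  · exact (hπ.integrable_cost.smul_measure ENNReal.ofReal_ne_top).add_measure
      (hπ'.integrable_cost.smul_measure ENNReal.ofReal_ne_top)

lemma integral_convexComb {π π' : Measure (ℝ × ℝ)} {a a' : ℝ} (ha : 0 ≤ a) (ha' : 0 ≤ a')
    {g : ℝ × ℝ → ℝ} (hg : Integrable g π) (hg' : Integrable g π') :
    ∫ z, g z ∂(ENNReal.ofReal a • π + ENNReal.ofReal a' • π')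
      = a * ∫ z, g z ∂π + a' * ∫ z, g z ∂π' := by
  rw [integral_add_measure (hg.smul_measure ENNReal.ofReal_ne_top)
    (hg'.smul_measure ENNReal.ofReal_ne_top), integral_smul_measure, integral_smul_measure,
    ENNReal.toReal_ofReal ha, ENNReal.toReal_ofReal ha']
  rfl

lemma isPlan_map [IsProbabilityMeasure P₀] (hp : 1 ≤ p) (hP₀ : P₀ Ξᶜ = 0)
    (hmom : Integrable (fun x : ℝ => |x| ^ p) P₀) {T : ℝ → ℝ} (hT : Measurable T) {m : ℝ}
    (hTΞ : ∀ x ∈ Ξ, T x ∈ Ξ) (hTm : ∀ x, T x = x ∨ x ≤ T x ∧ T x ≤ m) (hΞ : MeasurableSet Ξ) :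
    IsPlan Ξ p P₀ (P₀.map fun x => (T x, x)) := by
  have hp0 : 0 < p := by linarith
  have hm : Measurable fun x => (T x, x) := hT.prodMk measurable_id
  refine ⟨Measure.isProbabilityMeasure_map hm.aemeasurable, ?_, ?_, ?_⟩
  · rw [Measure.map_map measurable_snd hm]
    exact Measure.map_id
  · rw [Measure.map_map measurable_fst hm, Measure.map_apply (measurable_fst.comp hm) hΞ.compl]
    exact measure_mono_null (fun x hx hx' => hx (hTΞ x hx')) hP₀
  · rw [integrable_map_measure (measurable_cost p).aestronglyMeasurable hm.aemeasurable]
    have hbig : Integrable (fun x : ℝ => (2 * |m|) ^ p + 2 ^ p * |x| ^ p) P₀ :=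
      (integrable_const _).add (hmom.const_mul _)
    refine hbig.mono' ((measurable_cost p).comp hm).aestronglyMeasurable (ae_of_all _ fun x => ?_)
    have h0 : 0 ≤ |T x - x| ^ p := by positivity
    simp only [Function.comp, Real.norm_eq_abs, abs_of_nonneg h0]
    have h1 : |T x - x| ≤ |m| + |x| := by
      rcases hTm x with h | ⟨h, h'⟩
      · rw [h]; simp; positivity
      · rw [abs_of_nonneg (by linarith)]
        linarith [le_abs_self m, neg_abs_le x]
    have e1 : (2 * |x|) ^ p = 2 ^ p * |x| ^ p := Real.mul_rpow (by norm_num) (abs_nonneg x)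
    rw [← e1]
    have h2 : 0 ≤ (2 * |x|) ^ p := by positivity
    have h3 : 0 ≤ (2 * |m|) ^ p := by positivity
    rcases le_total |m| |x| with h | h
    · have := Real.rpow_le_rpow (abs_nonneg _) (h1.trans (by linarith : _ ≤ 2 * |x|)) hp0.le
      linarith
    · have := Real.rpow_le_rpow (abs_nonneg _) (h1.trans (by linarith : _ ≤ 2 * |m|)) hp0.le
      linarith

lemma cost_map {T : ℝ → ℝ} (hT : Measurable T) :
    cost p (P₀.map fun x => (T x, x)) = ∫ x, |T x - x| ^ p ∂P₀ := by
  have hm : Measurable fun x => (T x, x) := hT.prodMk measurable_id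
  rw [cost, integral_map hm.aemeasurable (measurable_cost p).aestronglyMeasurable]

lemma isPlan_diag [IsProbabilityMeasure P₀] (hp : 1 ≤ p) (hP₀ : P₀ Ξᶜ = 0)
    (hmom : Integrable (fun x : ℝ => |x| ^ p) P₀) (hΞ : MeasurableSet Ξ) :
    IsPlan Ξ p P₀ (P₀.map fun x => (x, x)) :=
  isPlan_map hp hP₀ hmom (T := fun x => x) measurable_id (m := 0) (fun _ h => h)
    (fun _ => Or.inl rfl) hΞ

lemma cost_diag (hp : 1 ≤ p) : cost p (P₀.map fun x => (x, x)) = 0 := by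
  have h := cost_map (p := p) (P₀ := P₀) (T := fun x => x) measurable_id
  simpa [Real.zero_rpow (by linarith : p ≠ 0)] using h

lemma center_mem [IsProbabilityMeasure P₀] (hp : 1 ≤ p) (hδ : 0 ≤ δ) (hP₀ : P₀ Ξᶜ = 0)
    (hmom : Integrable (fun x : ℝ => |x| ^ p) P₀) (hΞ : MeasurableSet Ξ) :
    P₀ ∈ wassersteinBall Ξ p δ P₀ := by
  have h := (isPlan_diag hp hP₀ hmom hΞ).map_fst_mem hp hδ (by rw [cost_diag hp]; positivity)
  have hm : Measurable fun x : ℝ => (x, x) := measurable_id.prodMk measurable_id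
  rw [Measure.map_map measurable_fst hm] at h
  simpa [Function.comp_def] using h

lemma integrable_of_mem (hp : 1 ≤ p) (hδ : 0 ≤ δ) [IsProbabilityMeasure P₀]
    (hmom : Integrable (fun x : ℝ => |x| ^ p) P₀)
    {P : Measure ℝ} (hP : P ∈ wassersteinBall Ξ p δ P₀) : Integrable (fun x : ℝ => x) P := by
  obtain ⟨π, hπ, rfl, -⟩ := exists_plan hp hδ hP one_pos
  have := hπ.prob
  refine (integrable_map_measure measurable_id.aestronglyMeasurable
    measurable_fst.aemeasurable).2 ?_
  have h0 : Integrable (fun z : ℝ × ℝ => |z.2| ^ p) π := by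
    have h := hmom
    rw [← hπ.map_snd, integrable_map_measure (by
      exact (measurable_norm.pow_const p).aestronglyMeasurable) measurable_snd.aemeasurable] at h
    exact h
  refine ((integrable_const (2 : ℝ)).add (h0.add hπ.integrable_cost)).mono'
    measurable_fst.aestronglyMeasurable (ae_of_all _ fun z => ?_)
  have h1 := le_one_add_rpow hp (abs_nonneg z.2)
  have h2 := le_one_add_rpow hp (abs_nonneg (z.1 - z.2))
  have h3 : |z.1| ≤ |z.2| + |z.1 - z.2| := by
    have := abs_add_le z.2 (z.1 - z.2)
    rwa [add_sub_cancel] at this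
  simp only [Function.comp, id, Real.norm_eq_abs, Pi.add_apply]
  linarith

lemma integrable_clip {α : Type*} [MeasurableSpace α] (μ : Measure α) [IsFiniteMeasure μ]
    {v : ℝ} (hv : 0 ≤ v) {g : α → ℝ} (hg : Measurable g) : Integrable (fun x => clip v (g x)) μ :=
  (integrable_const v).mono' ((continuous_clip v).measurable.comp hg).aestronglyMeasurable
    (ae_of_all _ fun _ => abs_clip_le hv _)

/-- Lagrangian relaxation of the transport budget. -/
theorem exists_multiplier [IsProbabilityMeasure P₀] (hp : 1 ≤ p) (hδ : 0 ≤ δ) (hP₀ : P₀ Ξᶜ = 0)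
    (hmom : Integrable (fun x : ℝ => |x| ^ p) P₀) (hΞ : MeasurableSet Ξ) {v θ H ε : ℝ}
    (hv : 0 ≤ v) (hH : ∀ P ∈ wassersteinBall Ξ p δ P₀, ∫ x, clip v (x - θ) ∂P ≤ H) (hε : 0 < ε) :
    ∃ l, 0 < l ∧ ∀ π, IsPlan Ξ p P₀ π →
      ∫ z, clip v (z.1 - θ) ∂π ≤ H + l * (cost p π - δ ^ p) + ε := by
  have hfst : Measurable fun x : ℝ => clip v (x - θ) :=
    (continuous_clip v).measurable.comp (by fun_prop)
  have hmap : ∀ π : Measure (ℝ × ℝ),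
      ∫ x, clip v (x - θ) ∂(π.map Prod.fst) = ∫ z, clip v (z.1 - θ) ∂π := fun π =>
    integral_map measurable_fst.aemeasurable hfst.aestronglyMeasurable
  -- At radius zero no plan lies strictly below the budget, as the supergradient argument requires;
  -- the Lipschitz bound `clip_sub_le` yields the multiplier `ε ^ (1 - p)` instead.
  rcases hδ.eq_or_lt with rfl | hδ0
  · refine ⟨ε ^ (1 - p), by positivity, fun π hπ => ?_⟩
    have := hπ.prob
    have h0 := hH P₀ (center_mem hp le_rfl hP₀ hmom hΞ)
    have h1 : ∫ x, clip v (x - θ) ∂P₀ = ∫ z, clip v (z.2 - θ) ∂π := by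
      rw [← hπ.map_snd]
      exact integral_map measurable_snd.aemeasurable hfst.aestronglyMeasurable
    have i1 : Integrable (fun z : ℝ × ℝ => clip v (z.1 - θ)) π :=
      integrable_clip π hv (by fun_prop)
    have i2 : Integrable (fun z : ℝ × ℝ => clip v (z.2 - θ)) π :=
      integrable_clip π hv (by fun_prop)
    have i3 := hπ.integrable_cost.const_mul (ε ^ (1 - p))
    have i4 : Integrable (fun z : ℝ × ℝ => ε + ε ^ (1 - p) * |z.1 - z.2| ^ p) π :=
      (integrable_const ε).add i3
    have h2 : ∫ z, clip v (z.1 - θ) ∂π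
        ≤ ∫ z, (clip v (z.2 - θ) + (ε + ε ^ (1 - p) * |z.1 - z.2| ^ p)) ∂π := by
      refine integral_mono i1 (i2.add i4) fun z => ?_
      have := clip_sub_le v (z.1 - θ) (z.2 - θ)
      rw [sub_sub_sub_cancel_right] at this
      linarith [le_add_mul_rpow hp hε (abs_nonneg (z.1 - z.2))]
    rw [integral_add i2 i4, integral_add (integrable_const ε) i3,
      integral_const_mul] at h2
    simp only [integral_const, probReal_univ, one_smul] at h2
    rw [Real.zero_rpow (by linarith), sub_zero, cost]
    linarith
  · have hc : 0 < δ ^ p := by positivity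
    let S : Set (ℝ × ℝ) := {z | ∃ π, IsPlan Ξ p P₀ π ∧ z = (cost p π, ∫ z, clip v (z.1 - θ) ∂π)}
    have hS : Convex ℝ S := by
      rintro _ ⟨π, hπ, rfl⟩ _ ⟨π', hπ', rfl⟩ a a' ha ha' haa
      have := hπ.prob
      have := hπ'.prob
      refine ⟨_, hπ.convexComb hπ' ha ha' haa, ?_⟩
      rw [cost, cost, cost, integral_convexComb ha ha' hπ.integrable_cost hπ'.integrable_cost,
        integral_convexComb ha ha' (integrable_clip π hv (by fun_prop))
          (integrable_clip π' hv (by fun_prop))]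
      rfl
    obtain ⟨l, hl, h⟩ := exists_supergradient hS hc (H := H)
      (f₀ := ∫ z, clip v (z.1 - θ) ∂(P₀.map fun x => (x, x)))
      ⟨_, isPlan_diag hp hP₀ hmom hΞ, by rw [cost_diag hp]⟩ (by
        rintro _ ⟨π, hπ, rfl⟩ hle
        have := hH _ (hπ.map_fst_mem hp hδ hle)
        rwa [hmap] at this)
    -- The supergradient may be `0`; the increment makes it positive at a price of at most `ε`.
    refine ⟨l + ε / δ ^ p, by positivity, fun π hπ => ?_⟩
    have h1 := h _ ⟨π, hπ, rfl⟩
    have h2 : ε / δ ^ p * (cost p π - δ ^ p) = ε / δ ^ p * cost p π - ε := by field_simp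
    have h3 : 0 ≤ ε / δ ^ p * cost p π := mul_nonneg (by positivity) (cost_nonneg _ _)
    simp only at h1
    linarith

/-! ### Concavity in the truncation level -/

/-- Midpoint-type concavity of the worst-case truncated gain, at levels `v` for which the support
set reaches beyond the saturation point `θ + v`. -/
lemma worst_clip_concave_aux [IsProbabilityMeasure P₀] (hp : 1 ≤ p) (hδ : 0 ≤ δ)
    (hP₀ : P₀ Ξᶜ = 0) (hmom : Integrable (fun x : ℝ => |x| ^ p) P₀) (hΞ : MeasurableSet Ξ)
    (hconv : Convex ℝ Ξ) {v₁ v₂ θ H a₁ a₂ : ℝ} (hv₁ : 0 ≤ v₁) (hv₂ : 0 ≤ v₂)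
    (ha₁ : 0 ≤ a₁) (ha₂ : 0 ≤ a₂) (ha : a₁ + a₂ = 1) (hv : 0 < a₁ * v₁ + a₂ * v₂)
    (hreach : ∃ x ∈ Ξ, θ + (a₁ * v₁ + a₂ * v₂) ≤ x)
    (hH : ∀ P ∈ wassersteinBall Ξ p δ P₀, ∫ x, clip (a₁ * v₁ + a₂ * v₂) (x - θ) ∂P ≤ H)
    {P₁ P₂ : Measure ℝ} (hP₁ : P₁ ∈ wassersteinBall Ξ p δ P₀)
    (hP₂ : P₂ ∈ wassersteinBall Ξ p δ P₀) :
    a₁ * ∫ x, clip v₁ (x - θ) ∂P₁ + a₂ * ∫ x, clip v₂ (x - θ) ∂P₂ ≤ H := by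
  set v := a₁ * v₁ + a₂ * v₂ with hvdef
  refine le_of_forall_pos_le_add fun ε hε => ?_
  obtain ⟨l, hl, hlag⟩ := exists_multiplier hp hδ hP₀ hmom hΞ hv.le hH hε
  obtain ⟨k, T, A, A', cert⟩ := exists_certificate hp hl hv
  obtain ⟨m, hm, hvm⟩ := hreach
  let S : ℝ → ℝ := fun x => θ + T (x - θ)
  have hS : Measurable S := (cert.measurable_map.comp (by fun_prop)).const_add θ
  have hS_or : ∀ x, S x = x ∨ x ≤ S x ∧ S x ≤ θ + v := fun x => by
    rcases cert.map_eq_or (x - θ) with h | ⟨h, h'⟩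
    · left; simp only [S, h]; ring
    · right; constructor <;> simp only [S] <;> linarith
  -- A moved point lies between `x` and `m`, both in `Ξ`, because `θ + v ≤ m`.
  have hSΞ : ∀ x ∈ Ξ, S x ∈ Ξ := fun x hx => by
    rcases hS_or x with h | ⟨h, h'⟩
    · rwa [h]
    · exact hconv.ordConnected.out hx hm ⟨h, h'.trans hvm⟩
  have hplan := isPlan_map hp hP₀ hmom hS hSΞ hS_or hΞ
  have hSm : Measurable fun x => (S x, x) := hS.prodMk measurable_id
  have hclip : Measurable fun z : ℝ × ℝ => clip v (z.1 - θ) :=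
    (continuous_clip v).measurable.comp (by fun_prop)
  have hA : Integrable (fun x => A (x - θ)) P₀ :=
    (integrable_const v).mono' (cert.measurable_value.comp (by fun_prop)).aestronglyMeasurable
      (ae_of_all _ fun x => by
        rw [Real.norm_eq_abs, abs_of_nonneg (cert.value_mem _).1]; exact (cert.value_mem _).2)
  have hA' : Integrable (fun x => A' (x - θ)) P₀ :=
    (integrable_const 1).mono' (cert.measurable_slope.comp (by fun_prop)).aestronglyMeasurable
      (ae_of_all _ fun x => by
        rw [Real.norm_eq_abs, abs_of_nonneg (cert.slope_mem _).1]; exact (cert.slope_mem _).2)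
  have lower : ∫ x, A (x - θ) ∂P₀ ≤ H - l * δ ^ p + ε := by
    have h1 := hlag _ hplan
    have hc : Integrable (fun x => |S x - x| ^ p) P₀ := by
      have := hplan.integrable_cost
      rwa [integrable_map_measure (measurable_cost p).aestronglyMeasurable hSm.aemeasurable] at this
    rw [cost_map hS, integral_map hSm.aemeasurable hclip.aestronglyMeasurable] at h1
    have h2 : ∫ x, A (x - θ) ∂P₀ ≤ ∫ x, (clip v (S x - θ) - l * |S x - x| ^ p) ∂P₀ := by
      refine integral_mono hA ((integrable_clip P₀ hv.le (by fun_prop)).sub (hc.const_mul l))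
        fun x => ?_
      have := cert.value_le (x - θ)
      have e1 : S x - θ = T (x - θ) := by simp only [S]; ring
      have e2 : S x - x = T (x - θ) - (x - θ) := by simp only [S]; ring
      simpa only [e1, e2] using this
    rw [integral_sub (integrable_clip P₀ hv.le (by fun_prop)) (hc.const_mul l),
      integral_const_mul] at h2
    simp only at h1
    linarith
  have upper : ∀ w, 0 ≤ w → ∀ P ∈ wassersteinBall Ξ p δ P₀, ∫ x, clip w (x - θ) ∂P ≤
      (l + k * (w - v)) * δ ^ p + ∫ x, A (x - θ) ∂P₀ + (w - v) * ∫ x, A' (x - θ) ∂P₀ := by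
    intro w hw P hP
    have hlw : 0 ≤ l + k * (w - v) := by
      nlinarith [cert.k_nonneg, cert.k_mul_le, mul_nonneg cert.k_nonneg hw]
    -- Near-optimal plans suffice, so no optimal coupling is needed; `η` tends to zero below.
    have main : ∀ η, 0 < η → ∫ x, clip w (x - θ) ∂P ≤ (l + k * (w - v)) * (δ ^ p + η) +
        ∫ x, A (x - θ) ∂P₀ + (w - v) * ∫ x, A' (x - θ) ∂P₀ := by
      intro η hη
      obtain ⟨π, hπ, rfl, hcost⟩ := exists_plan hp hδ hP hη
      have := hπ.prob
      have hcw : Measurable fun x : ℝ => clip w (x - θ) :=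
        (continuous_clip w).measurable.comp (by fun_prop)
      rw [integral_map measurable_fst.aemeasurable hcw.aestronglyMeasurable]
      have snd : ∀ g : ℝ → ℝ, Integrable g P₀ →
          Integrable (fun z : ℝ × ℝ => g z.2) π ∧ ∫ z, g z.2 ∂π = ∫ x, g x ∂P₀ := by
        intro g hg
        rw [← hπ.map_snd] at hg ⊢
        exact ⟨(integrable_map_measure hg.aestronglyMeasurable measurable_snd.aemeasurable).1 hg,
          (integral_map measurable_snd.aemeasurable hg.aestronglyMeasurable).symm⟩
      obtain ⟨j1, e1⟩ := snd _ hA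
      obtain ⟨j2, e2⟩ := snd _ hA'
      have j3 := hπ.integrable_cost.const_mul (l + k * (w - v))
      have j4 : Integrable (fun z : ℝ × ℝ => A (z.2 - θ) + (w - v) * A' (z.2 - θ)) π :=
        j1.add (j2.const_mul (w - v))
      have h : ∫ z, clip w (z.1 - θ) ∂π ≤ ∫ z, ((l + k * (w - v)) * |z.1 - z.2| ^ p +
          (A (z.2 - θ) + (w - v) * A' (z.2 - θ))) ∂π := by
        refine integral_mono (integrable_clip π hw (by fun_prop))
          (j3.add j4) fun z => ?_
        have := cert.le_line (z.2 - θ) w (z.1 - θ) hw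
        rw [sub_sub_sub_cancel_right] at this
        simp only
        linarith
      rw [integral_add j3 j4, integral_add j1 (j2.const_mul (w - v)),
        integral_const_mul, integral_const_mul, e1, e2] at h
      have := mul_le_mul_of_nonneg_left hcost hlw
      rw [cost] at this
      linarith
    refine le_of_forall_pos_le_add fun η hη => ?_
    have h1 := main (η / (l + k * (w - v) + 1)) (by positivity)
    have h2 : (l + k * (w - v)) * (η / (l + k * (w - v) + 1)) ≤ η := by
      rw [mul_div_assoc', div_le_iff₀ (by linarith)]
      nlinarith
    linarith
  have u1 := mul_le_mul_of_nonneg_left (upper v₁ hv₁ P₁ hP₁) ha₁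
  have u2 := mul_le_mul_of_nonneg_left (upper v₂ hv₂ P₂ hP₂) ha₂
  generalize ∫ x, A (x - θ) ∂P₀ = I at *
  generalize ∫ x, A' (x - θ) ∂P₀ = I' at *
  generalize δ ^ p = c at *
  -- The deviations `v₁ - v` and `v₂ - v` average to zero, leaving the common value at `v`.
  have e : a₁ * ((l + k * (v₁ - v)) * c + I + (v₁ - v) * I') +
      a₂ * ((l + k * (v₂ - v)) * c + I + (v₂ - v) * I') = l * c + I := by
    have e2 : a₂ = 1 - a₁ := by linarith
    rw [hvdef, e2]; ring
  linarith

lemma integral_clip_nonneg (P : Measure ℝ) {v : ℝ} (hv : 0 ≤ v) (θ : ℝ) :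
    0 ≤ ∫ x, clip v (x - θ) ∂P :=
  integral_nonneg fun _ => clip_nonneg hv _

lemma integral_clip_le (P : Measure ℝ) [IsProbabilityMeasure P] {v : ℝ} (hv : 0 ≤ v) (θ : ℝ) :
    ∫ x, clip v (x - θ) ∂P ≤ v := by
  have := integral_mono (integrable_clip P hv (g := fun x => x - θ) (by fun_prop))
    (integrable_const v) fun x => clip_le v (x - θ)
  simpa using this

lemma integral_const_add_mul_clip (P : Measure ℝ) [IsProbabilityMeasure P] {v : ℝ} (hv : 0 ≤ v)
    {g : ℝ → ℝ} (hg : Measurable g) (c s : ℝ) :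
    ∫ x, (c + s * clip v (g x)) ∂P = c + s * ∫ x, clip v (g x) ∂P := by
  rw [integral_add (integrable_const _) ((integrable_clip P hv hg).const_mul s),
    integral_const_mul]
  simp

/-- Concavity, in the truncation level, of the worst-case truncated gain. -/
theorem worst_clip_concave [IsProbabilityMeasure P₀] (hp : 1 ≤ p) (hδ : 0 ≤ δ)
    (hP₀ : P₀ Ξᶜ = 0) (hmom : Integrable (fun x : ℝ => |x| ^ p) P₀) (hΞ : IsClosed Ξ)
    (hconv : Convex ℝ Ξ) {v₁ v₂ θ H a₁ a₂ : ℝ} (hv₁ : 0 ≤ v₁) (hv₂ : 0 ≤ v₂)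
    (ha₁ : 0 ≤ a₁) (ha₂ : 0 ≤ a₂) (ha : a₁ + a₂ = 1)
    (hH : ∀ P ∈ wassersteinBall Ξ p δ P₀, ∫ x, clip (a₁ * v₁ + a₂ * v₂) (x - θ) ∂P ≤ H)
    {P₁ P₂ : Measure ℝ} (hP₁ : P₁ ∈ wassersteinBall Ξ p δ P₀)
    (hP₂ : P₂ ∈ wassersteinBall Ξ p δ P₀) :
    a₁ * ∫ x, clip v₁ (x - θ) ∂P₁ + a₂ * ∫ x, clip v₂ (x - θ) ∂P₂ ≤ H := by
  have of_reach : ∀ w₁ w₂, 0 ≤ w₁ → 0 ≤ w₂ →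
      (a₁ * w₁ + a₂ * w₂ ≤ 0 ∨ ∃ x ∈ Ξ, θ + (a₁ * w₁ + a₂ * w₂) ≤ x) →
      (∀ P ∈ wassersteinBall Ξ p δ P₀, ∫ x, clip (a₁ * w₁ + a₂ * w₂) (x - θ) ∂P ≤ H) →
      a₁ * ∫ x, clip w₁ (x - θ) ∂P₁ + a₂ * ∫ x, clip w₂ (x - θ) ∂P₂ ≤ H := by
    intro w₁ w₂ hw₁ hw₂ hor hHw
    have hw0 : 0 ≤ a₁ * w₁ + a₂ * w₂ := by positivity
    rcases hw0.eq_or_lt with h0 | hpos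
    · have := hP₁.1
      have := hP₂.1
      have h1 := mul_le_mul_of_nonneg_left (integral_clip_le P₁ hw₁ θ) ha₁
      have h2 := mul_le_mul_of_nonneg_left (integral_clip_le P₂ hw₂ θ) ha₂
      have h3 := (integral_clip_nonneg P₁ hw0 θ).trans (hHw P₁ hP₁)
      linarith
    · exact worst_clip_concave_aux hp hδ hP₀ hmom hΞ.measurableSet hconv hw₁ hw₂ ha₁ ha₂ ha hpos
        (hor.resolve_left (not_le.2 hpos)) hHw hP₁ hP₂
  by_cases hreach : ∃ x ∈ Ξ, θ + (a₁ * v₁ + a₂ * v₂) ≤ x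
  · exact of_reach v₁ v₂ hv₁ hv₂ (Or.inr hreach) hH
  · push Not at hreach
    have hne : Ξ.Nonempty := by
      by_contra h
      rw [not_nonempty_iff_eq_empty] at h
      simp [h] at hP₀
    have hbdd : BddAbove Ξ := ⟨_, fun x hx => (hreach x hx).le⟩
    have hM : sSup Ξ ∈ Ξ := hΞ.csSup_mem hne hbdd
    set M := sSup Ξ
    -- On `Ξ` no gain exceeds `m`, so levels above `m` act like `m`. After this cut the mean level
    -- is either `0` or reached by `M` itself.
    set m := max (M - θ) 0 with hm
    have hm0 : 0 ≤ m := le_max_right _ _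
    have hclip : ∀ w, ∀ P ∈ wassersteinBall Ξ p δ P₀,
        ∫ x, clip w (x - θ) ∂P = ∫ x, clip (min w m) (x - θ) ∂P := by
      intro w P hP
      have hae : ∀ᵐ x ∂P, x ∈ Ξ := by rw [ae_iff]; exact hP.2.1
      refine integral_congr_ae (hae.mono fun x hx => ?_)
      have : max (x - θ) 0 ≤ m := max_le_max (by linarith [le_csSup hbdd hx]) le_rfl
      simp only [clip]
      rw [min_assoc, min_eq_right this]
    rw [hclip v₁ P₁ hP₁, hclip v₂ P₂ hP₂]
    have e1 : a₁ * min v₁ m ≤ a₁ * m := by gcongr; exact min_le_right _ _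
    have e2 : a₂ * min v₂ m ≤ a₂ * m := by gcongr; exact min_le_right _ _
    have e3 : a₁ * m + a₂ * m = m := by rw [← add_mul, ha, one_mul]
    have e4 : a₁ * min v₁ m ≤ a₁ * v₁ := by gcongr; exact min_le_left _ _
    have e5 : a₂ * min v₂ m ≤ a₂ * v₂ := by gcongr; exact min_le_left _ _
    have w1 : 0 ≤ min v₁ m := le_min hv₁ hm0
    have w2 : 0 ≤ min v₂ m := le_min hv₂ hm0
    refine of_reach _ _ w1 w2 ?_ fun P hP => le_trans ?_ (hH P hP)
    · rcases le_total (M - θ) 0 with h | h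
      · left; rw [hm, max_eq_right h] at e1 e2 e3 ⊢; linarith
      · right; refine ⟨M, hM, ?_⟩
        have : m = M - θ := max_eq_left h
        linarith
    · have := hP.1
      exact integral_mono (integrable_clip P (by positivity) (by fun_prop))
        (integrable_clip P (by positivity) (by fun_prop))
        fun x => clip_mono (by linarith) le_rfl

/-! ### Reflection to the side below the order quantity -/

lemma map_neg_mem_wassersteinBall (hp : 1 ≤ p) {P : Measure ℝ} (hP : P ∈ wassersteinBall Ξ p δ P₀) :
    P.map Neg.neg ∈ wassersteinBall (-Ξ) p δ (P₀.map Neg.neg) := by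
  have hneg : Measurable (Neg.neg : ℝ → ℝ) := measurable_neg
  obtain ⟨hprob, hΞ, hW⟩ := hP
  refine ⟨Measure.isProbabilityMeasure_map hneg.aemeasurable, ?_, le_trans ?_ hW⟩
  · rw [show (Neg.neg : ℝ → ℝ) = MeasurableEquiv.neg ℝ from rfl, MeasurableEquiv.map_apply]
    have : (MeasurableEquiv.neg ℝ) ⁻¹' (-Ξ)ᶜ = Ξᶜ := by ext x; simp
    rwa [this]
  · unfold wassersteinDist
    have hp0 : 0 < p := by linarith
    refine ENNReal.rpow_le_rpow (le_iInf₂ fun π hπ => ?_) (by positivity)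
    have hm : Measurable (Prod.map Neg.neg Neg.neg : ℝ × ℝ → ℝ × ℝ) := hneg.prodMap hneg
    refine le_trans (iInf₂_le (π.map (Prod.map Neg.neg Neg.neg)) (And.intro ?_ ?_)) (le_of_eq ?_)
    · rw [Measure.map_map measurable_fst hm, ← hπ.1, Measure.map_map hneg measurable_fst]
      rfl
    · rw [Measure.map_map measurable_snd hm, ← hπ.2, Measure.map_map hneg measurable_snd]
      rfl
    · rw [lintegral_map (measurable_cost p).ennreal_ofReal hm]
      refine lintegral_congr fun z => ?_
      simp only [Prod.map_fst, Prod.map_snd]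
      rw [← abs_neg]
      congr 3
      ring

lemma map_neg_map_neg (P : Measure ℝ) : (P.map Neg.neg).map Neg.neg = P := by
  rw [Measure.map_map measurable_neg measurable_neg]
  simp

theorem worst_clip_neg_concave [IsProbabilityMeasure P₀] (hp : 1 ≤ p) (hδ : 0 ≤ δ)
    (hP₀ : P₀ Ξᶜ = 0) (hmom : Integrable (fun x : ℝ => |x| ^ p) P₀) (hΞ : IsClosed Ξ)
    (hconv : Convex ℝ Ξ) {v₁ v₂ θ H a₁ a₂ : ℝ} (hv₁ : 0 ≤ v₁) (hv₂ : 0 ≤ v₂)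
    (ha₁ : 0 ≤ a₁) (ha₂ : 0 ≤ a₂) (ha : a₁ + a₂ = 1)
    (hH : ∀ P ∈ wassersteinBall Ξ p δ P₀, ∫ x, clip (a₁ * v₁ + a₂ * v₂) (θ - x) ∂P ≤ H)
    {P₁ P₂ : Measure ℝ} (hP₁ : P₁ ∈ wassersteinBall Ξ p δ P₀)
    (hP₂ : P₂ ∈ wassersteinBall Ξ p δ P₀) :
    a₁ * ∫ x, clip v₁ (θ - x) ∂P₁ + a₂ * ∫ x, clip v₂ (θ - x) ∂P₂ ≤ H := by
  have hneg : Measurable (Neg.neg : ℝ → ℝ) := measurable_neg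
  have flip : ∀ (w : ℝ) (P : Measure ℝ),
      ∫ x, clip w (x - -θ) ∂(P.map Neg.neg) = ∫ x, clip w (θ - x) ∂P := by
    intro w P
    have hm : Measurable fun x : ℝ => clip w (x - -θ) :=
      (continuous_clip w).measurable.comp (by fun_prop)
    rw [integral_map hneg.aemeasurable hm.aestronglyMeasurable]
    congr 1; ext x; congr 1; ring
  have hprob : IsProbabilityMeasure (P₀.map Neg.neg) :=
    Measure.isProbabilityMeasure_map hneg.aemeasurable
  have h := worst_clip_concave (Ξ := -Ξ) (P₀ := P₀.map Neg.neg) (θ := -θ) (H := H) hp hδ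
    (map_neg_mem_wassersteinBall hp (center_mem hp hδ hP₀ hmom hΞ.measurableSet)).2.1
    ((integrable_map_measure (measurable_norm.pow_const p).aestronglyMeasurable
      hneg.aemeasurable).2 (by simpa [Function.comp_def] using hmom))
    hΞ.neg hconv.neg hv₁ hv₂ ha₁ ha₂ ha
    (fun P hP => by
      have hP' := map_neg_mem_wassersteinBall hp hP
      rw [neg_neg, map_neg_map_neg] at hP'
      rw [← map_neg_map_neg P, flip]
      exact hH _ hP')
    (map_neg_mem_wassersteinBall hp hP₁) (map_neg_mem_wassersteinBall hp hP₂)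
  rwa [flip, flip] at h

/-! ### From truncated gains to loss gaps and regret -/

lemma loss_sub_loss_of_ge {b s θ β : ℝ} (h : θ ≤ β) (x : ℝ) :
    loss b s θ x - loss b s β x = -b * (β - θ) + s * clip (β - θ) (x - θ) := by
  have : clip (β - θ) (x - θ) = min β x - min θ x := by
    unfold clip
    rcases le_total x θ with h1 | h1
    · rw [max_eq_right (by linarith), min_eq_right (by linarith), min_eq_right (by linarith),
        min_eq_right h1, sub_self]
    · rw [max_eq_left (by linarith), min_eq_left h1, min_sub_sub_right]
  rw [this]; unfold loss; ring

lemma loss_sub_loss_of_le {b s θ β : ℝ} (h : β ≤ θ) (x : ℝ) :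
    loss b s θ x - loss b s β x = (b - s) * (θ - β) + s * clip (θ - β) (θ - x) := by
  have : clip (θ - β) (θ - x) = θ - β - (min θ x - min β x) := by
    unfold clip
    rcases le_total θ x with h1 | h1
    · rw [max_eq_right (by linarith), min_eq_right (by linarith), min_eq_left h1,
        min_eq_left (by linarith)]
      ring
    · rw [max_eq_left (by linarith), min_eq_right h1, min_sub_sub_left]
      rcases le_total β x with h2 | h2
      · rw [max_eq_right h2, min_eq_left h2]; ring
      · rw [max_eq_left h2, min_eq_right h2]; ring
  rw [this]; unfold loss; ring

lemma integrable_loss {P : Measure ℝ} [IsFiniteMeasure P] (hP : Integrable (fun x : ℝ => x) P)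
    (b s β : ℝ) : Integrable (loss b s β) P :=
  (integrable_const (b * β)).sub (((integrable_const β).inf hP).const_mul s)

lemma abs_loss_sub_loss_le (b s θ β x : ℝ) :
    |loss b s θ x - loss b s β x| ≤ (|b| + |s|) * |θ - β| := by
  have h : |min θ x - min β x| ≤ |θ - β| := abs_inf_sub_inf_le_abs θ β x
  have e : loss b s θ x - loss b s β x = b * (θ - β) - s * (min θ x - min β x) := by
    unfold loss; ring
  rw [e, add_mul]
  refine (abs_sub _ _).trans ?_
  rw [abs_mul, abs_mul]
  gcongr

lemma worstCaseGap_eq_coe {ℓ : ℝ → ℝ → ℝ} {B : Set (Measure ℝ)} (hB : B.Nonempty) {β θ C : ℝ}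
    (hC : ∀ P ∈ B, |∫ x, (ℓ θ x - ℓ β x) ∂P| ≤ C) :
    worstCaseGap ℓ B β θ ≠ ⊤ ∧ worstCaseGap ℓ B β θ ≠ ⊥ ∧
      IsLUB ((fun P => ∫ x, (ℓ θ x - ℓ β x) ∂P) '' B) (worstCaseGap ℓ B β θ).toReal := by
  have hle : worstCaseGap ℓ B β θ ≤ (C : EReal) :=
    iSup₂_le fun P hP => EReal.coe_le_coe_iff.2 ((le_abs_self _).trans (hC P hP))
  have hge : ∀ P ∈ B, ((∫ x, (ℓ θ x - ℓ β x) ∂P : ℝ) : EReal) ≤ worstCaseGap ℓ B β θ :=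
    fun P hP => le_iSup₂ (f := fun (P : Measure ℝ) (_ : P ∈ B) =>
      ((∫ x, (ℓ θ x - ℓ β x) ∂P : ℝ) : EReal)) P hP
  have h1 : worstCaseGap ℓ B β θ ≠ ⊤ := (hle.trans_lt (EReal.coe_lt_top C)).ne
  have h2 : worstCaseGap ℓ B β θ ≠ ⊥ := by
    obtain ⟨P, hP⟩ := hB
    exact ((EReal.bot_lt_coe _).trans_le (hge P hP)).ne'
  have hcoe := EReal.coe_toReal h1 h2
  refine ⟨h1, h2, ?_, ?_⟩
  · rintro _ ⟨P, hP, rfl⟩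
    rw [← EReal.coe_le_coe_iff, hcoe]
    exact hge P hP
  · intro r hr
    rw [← EReal.coe_le_coe_iff, hcoe]
    exact iSup₂_le fun P hP => EReal.coe_le_coe_iff.2 (hr ⟨P, hP, rfl⟩)

/-- Subtraction from a real number is an order-reversing involution of the extended reals, so it
exchanges infimum and supremum, even over an empty set. -/
lemma coe_sub_iInf₂ (a : ℝ) (Θ : Set ℝ) (g : ℝ → EReal) :
    (a : EReal) - ⨅ β ∈ Θ, g β = ⨆ β ∈ Θ, ((a : EReal) - g β) := by
  apply le_antisymm
  · have hS : ∀ β ∈ Θ, (a : EReal) - g β ≤ ⨆ β ∈ Θ, ((a : EReal) - g β) := fun β hβ =>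
      le_iSup₂ (f := fun (β : ℝ) (_ : β ∈ Θ) => (a : EReal) - g β) β hβ
    have flip : ∀ x y : EReal, (a : EReal) - x ≤ y → (a : EReal) - y ≤ x := by
      intro x y h
      induction x <;> induction y <;>
        first
        | (norm_cast at h ⊢; linarith)
        | (simp_all; done)
        | exact absurd (le_bot_iff.1 h) (EReal.coe_ne_bot (_ - _))
    exact flip _ _ (le_iInf₂ fun β hβ => flip _ _ (hS β hβ))
  · exact iSup₂_le fun β hβ => EReal.sub_le_sub le_rfl (iInf₂_le β hβ)

lemma regret_eq_iSup_worstCaseGap {ℓ : ℝ → ℝ → ℝ} {Θ : Set ℝ} {B : Set (Measure ℝ)} {θ : ℝ}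
    (hθ : ∀ P ∈ B, Integrable (ℓ θ) P) (hΘ : ∀ P ∈ B, ∀ β ∈ Θ, Integrable (ℓ β) P) :
    regret ℓ Θ B θ = ⨆ β ∈ Θ, worstCaseGap ℓ B β θ := by
  have h : regret ℓ Θ B θ = ⨆ P ∈ B, ⨆ β ∈ Θ, ((∫ x, (ℓ θ x - ℓ β x) ∂P : ℝ) : EReal) := by
    refine iSup_congr fun P => iSup_congr fun hP => ?_
    rw [coe_sub_iInf₂]
    refine iSup_congr fun β => iSup_congr fun hβ => ?_
    rw [integral_sub (hθ P hP) (hΘ P hP β hβ), EReal.coe_sub]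
  rw [h, iSup₂_comm]
  rfl

lemma isLUB_convexComb_le {S T : Set ℝ} {x y z a a' : ℝ} (hS : IsLUB S x) (hT : IsLUB T y)
    (ha : 0 ≤ a) (ha' : 0 ≤ a') (h : ∀ s ∈ S, ∀ t ∈ T, a * s + a' * t ≤ z) :
    a * x + a' * y ≤ z := by
  refine ((hS.mul_left ha).add (hT.mul_left ha')).2 ?_
  rintro _ ⟨_, ⟨s, hs, rfl⟩, _, ⟨t, ht, rfl⟩, rfl⟩
  exact h s hs t ht

/-- Adding a linear term and rescaling preserve concavity of a worst-case gain. -/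
lemma linear_add_concave {B : Set (Measure ℝ)} {G : ℝ → Measure ℝ → ℝ} {v₁ v₂ a₁ a₂ : ℝ}
    (hG : ∀ H, (∀ P ∈ B, G (a₁ * v₁ + a₂ * v₂) P ≤ H) → ∀ P₁ ∈ B, ∀ P₂ ∈ B,
      a₁ * G v₁ P₁ + a₂ * G v₂ P₂ ≤ H) {c s H : ℝ} (hs : 0 ≤ s)
    (hH : ∀ P ∈ B, c * (a₁ * v₁ + a₂ * v₂) + s * G (a₁ * v₁ + a₂ * v₂) P ≤ H)
    {P₁ P₂ : Measure ℝ} (hP₁ : P₁ ∈ B) (hP₂ : P₂ ∈ B) :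
    a₁ * (c * v₁ + s * G v₁ P₁) + a₂ * (c * v₂ + s * G v₂ P₂) ≤ H := by
  rcases hs.eq_or_lt with rfl | hs
  · have := hH P₁ hP₁
    linarith
  · have := hG ((H - c * (a₁ * v₁ + a₂ * v₂)) / s) (fun P hP => by
      rw [le_div_iff₀ hs]; linarith [hH P hP]) P₁ hP₁ P₂ hP₂
    rw [le_div_iff₀ hs] at this
    linarith

end Newsvendor

theorem theorem2p1 (Ξ : Set ℝ) (hΞ_closed : IsClosed Ξ) (hΞ_convex : Convex ℝ Ξ)
    (P₀ : Measure ℝ) [IsProbabilityMeasure P₀] (hP₀ : P₀ Ξᶜ = 0)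
    (p : ℝ) (hp : 1 ≤ p) (hmom : Integrable (fun x : ℝ => |x| ^ p) P₀)
    (δ : ℝ) (hδ : 0 ≤ δ) (b s : ℝ) (hs : 0 ≤ s) (θ : ℝ) (hθ : 0 ≤ θ) :
    -- all expected losses over the ball are well defined
    (∀ P ∈ Newsvendor.wassersteinBall Ξ p δ P₀, ∀ β : ℝ, 0 ≤ β →
      Integrable (Newsvendor.loss b s β) P) ∧
    -- `h(β; θ)` is finite
    (∀ β : ℝ, 0 ≤ β →
      Newsvendor.worstCaseGap (Newsvendor.loss b s)
          (Newsvendor.wassersteinBall Ξ p δ P₀) β θ ≠ ⊤ ∧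
      Newsvendor.worstCaseGap (Newsvendor.loss b s)
          (Newsvendor.wassersteinBall Ξ p δ P₀) β θ ≠ ⊥) ∧
    -- `h(·; θ)` is concave on `[0, θ]` and on `[θ, ∞)`
    ConcaveOn ℝ (Icc 0 θ) (fun β => (Newsvendor.worstCaseGap (Newsvendor.loss b s)
      (Newsvendor.wassersteinBall Ξ p δ P₀) β θ).toReal) ∧
    ConcaveOn ℝ (Ici θ) (fun β => (Newsvendor.worstCaseGap (Newsvendor.loss b s)
      (Newsvendor.wassersteinBall Ξ p δ P₀) β θ).toReal) ∧
    -- the regret is the maximum of the two corresponding suprema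
    Newsvendor.regret (Newsvendor.loss b s) (Ici 0) (Newsvendor.wassersteinBall Ξ p δ P₀) θ =
      max
        (⨆ β ∈ Icc 0 θ, Newsvendor.worstCaseGap (Newsvendor.loss b s)
          (Newsvendor.wassersteinBall Ξ p δ P₀) β θ)
        (⨆ β ∈ Ici θ, Newsvendor.worstCaseGap (Newsvendor.loss b s)
          (Newsvendor.wassersteinBall Ξ p δ P₀) β θ) := by
  have hint : ∀ P ∈ Newsvendor.wassersteinBall Ξ p δ P₀, ∀ β : ℝ,
      Integrable (Newsvendor.loss b s β) P := by
    intro P hP β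
    have := hP.1
    exact Newsvendor.integrable_loss (Newsvendor.integrable_of_mem hp hδ hmom hP) b s β
  have hcenter := Newsvendor.center_mem hp hδ hP₀ hmom hΞ_closed.measurableSet
  have hgap := fun β => Newsvendor.worstCaseGap_eq_coe (ℓ := Newsvendor.loss b s) (β := β) (θ := θ)
    (C := (|b| + |s|) * |θ - β|) ⟨P₀, hcenter⟩ (fun P hP => by
      have := hP.1
      have := norm_integral_le_of_norm_le_const (μ := P)
        (f := fun x => Newsvendor.loss b s θ x - Newsvendor.loss b s β x)
        (ae_of_all _ fun x => Newsvendor.abs_loss_sub_loss_le b s θ β x)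
      simpa using this)
  refine ⟨fun P hP β _ => hint P hP β, fun β _ => ⟨(hgap β).1, (hgap β).2.1⟩,
    ⟨convex_Icc 0 θ, ?_⟩, ⟨convex_Ici θ, ?_⟩, ?_⟩
  · intro β₁ hβ₁ β₂ hβ₂ a₁ a₂ ha₁ ha₂ ha
    have hval : ∀ β ≤ θ, ∀ P ∈ Newsvendor.wassersteinBall Ξ p δ P₀,
        ∫ x, (Newsvendor.loss b s θ x - Newsvendor.loss b s β x) ∂P
          = (b - s) * (θ - β) + s * ∫ x, Newsvendor.clip (θ - β) (θ - x) ∂P := by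
      intro β hβ P hP
      have := hP.1
      simp only [Newsvendor.loss_sub_loss_of_le hβ]
      exact Newsvendor.integral_const_add_mul_clip P (sub_nonneg.2 hβ) (by fun_prop) _ s
    have hmid : a₁ * (θ - β₁) + a₂ * (θ - β₂) = θ - (a₁ * β₁ + a₂ * β₂) := by
      rw [eq_sub_of_add_eq' ha]; ring
    have hle : a₁ * β₁ + a₂ * β₂ ≤ θ := ((convex_Icc 0 θ) hβ₁ hβ₂ ha₁ ha₂ ha).2
    -- The two suprema may be approached by different measures, so arbitrary pairs `P₁`, `P₂` are
    -- compared with the least upper bound at the mean.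
    refine Newsvendor.isLUB_convexComb_le (hgap β₁).2.2 (hgap β₂).2.2 ha₁ ha₂ ?_
    rintro _ ⟨P₁, hP₁, rfl⟩ _ ⟨P₂, hP₂, rfl⟩
    simp only [smul_eq_mul]
    rw [hval β₁ hβ₁.2 P₁ hP₁, hval β₂ hβ₂.2 P₂ hP₂]
    refine Newsvendor.linear_add_concave (B := Newsvendor.wassersteinBall Ξ p δ P₀)
      (G := fun v P => ∫ x, Newsvendor.clip v (θ - x) ∂P)
      (fun H hH P₁ hP₁ P₂ hP₂ => Newsvendor.worst_clip_neg_concave hp hδ hP₀ hmom hΞ_closed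
        hΞ_convex (by linarith [hβ₁.2]) (by linarith [hβ₂.2]) ha₁ ha₂ ha hH hP₁ hP₂)
      hs (fun P hP => ?_) hP₁ hP₂
    rw [hmid, ← hval _ hle P hP]
    exact (hgap _).2.2.1 ⟨P, hP, rfl⟩
  · intro β₁ hβ₁ β₂ hβ₂ a₁ a₂ ha₁ ha₂ ha
    have hval : ∀ β, θ ≤ β → ∀ P ∈ Newsvendor.wassersteinBall Ξ p δ P₀,
        ∫ x, (Newsvendor.loss b s θ x - Newsvendor.loss b s β x) ∂P
          = -b * (β - θ) + s * ∫ x, Newsvendor.clip (β - θ) (x - θ) ∂P := by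
      intro β hβ P hP
      have := hP.1
      simp only [Newsvendor.loss_sub_loss_of_ge hβ]
      exact Newsvendor.integral_const_add_mul_clip P (sub_nonneg.2 hβ) (by fun_prop) _ s
    have hmid : a₁ * (β₁ - θ) + a₂ * (β₂ - θ) = a₁ * β₁ + a₂ * β₂ - θ := by
      rw [eq_sub_of_add_eq' ha]; ring
    have hle : θ ≤ a₁ * β₁ + a₂ * β₂ := (convex_Ici θ) hβ₁ hβ₂ ha₁ ha₂ ha
    refine Newsvendor.isLUB_convexComb_le (hgap β₁).2.2 (hgap β₂).2.2 ha₁ ha₂ ?_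
    rintro _ ⟨P₁, hP₁, rfl⟩ _ ⟨P₂, hP₂, rfl⟩
    simp only [smul_eq_mul]
    rw [hval β₁ hβ₁ P₁ hP₁, hval β₂ hβ₂ P₂ hP₂]
    refine Newsvendor.linear_add_concave (B := Newsvendor.wassersteinBall Ξ p δ P₀)
      (G := fun v P => ∫ x, Newsvendor.clip v (x - θ) ∂P)
      (fun H hH P₁ hP₁ P₂ hP₂ => Newsvendor.worst_clip_concave hp hδ hP₀ hmom hΞ_closed
        hΞ_convex (sub_nonneg.2 hβ₁) (sub_nonneg.2 hβ₂) ha₁ ha₂ ha hH hP₁ hP₂)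
      hs (fun P hP => ?_) hP₁ hP₂
    rw [hmid, ← hval _ hle P hP]
    exact (hgap _).2.2.1 ⟨P, hP, rfl⟩
  · rw [Newsvendor.regret_eq_iSup_worstCaseGap (fun P hP => hint P hP θ)
      (fun P hP β _ => hint P hP β), ← Icc_union_Ici_eq_Ici hθ, iSup_union]
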